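/- Let $G$ be a (discrete) nilpotent group of class two, i.e. of nilpotency class at most $2$, generated by two abelian subgroups $X$ and $Y$. Then $X$ and $Y$ are $\frac{1}{\sqrt 2}$-orthogonal. That is, for every unitary representation of $G$ on a complex Hilbert space $V$ without nonzero $G$-invariant vectors, the subspaces $V^X$ and $V^Y$ of $X$-invariant and $Y$-invariant vectors satisfy $$|\langle x,y\rangle|\le \tfrac{1}{\sqrt 2}\,\|x\|\,\|y\|\qquad\text{for all } x\in V^X,\ y\in V^Y.$$ -/

import Mathlib

universe u v

/-- A unitary representation of the (discrete) group `G` on the Hilbert space `V`: a homomorphism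
from `G` to the group of surjective linear isometries of `V`. -/
abbrev UnitaryRep (G : Type*) [Group G] (V : Type*) [NormedAddCommGroup V]
    [InnerProductSpace ℂ V] : Type _ :=
  G →* (V ≃ₗᵢ[ℂ] V)

namespace UnitaryRep

/-- The subspace `V^H` of vectors fixed by every element of the subgroup `H`. -/
def fixedSubspace {G : Type*} [Group G] {V : Type*} [NormedAddCommGroup V]
    [InnerProductSpace ℂ V] (π : UnitaryRep G V) (H : Subgroup G) : Submodule ℂ V where
  carrier := {v | ∀ h ∈ H, π h v = v}
  add_mem' := by
    intro a b ha hb h hh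
    rw [map_add, ha h hh, hb h hh]
  zero_mem' := fun h _ => map_zero (π h)
  smul_mem' := by
    intro c a ha h hh
    rw [map_smul, ha h hh]

end UnitaryRep

/-- Two subspaces `A`, `B` of a complex inner product space are `ε`-orthogonal if
`|⟨a, b⟩| ≤ ε ‖a‖ ‖b‖` for all `a ∈ A` and `b ∈ B`. -/
def SubspaceEpsOrthogonal {V : Type*} [NormedAddCommGroup V] [InnerProductSpace ℂ V]
    (ε : ℝ) (A B : Submodule ℂ V) : Prop :=
  ∀ a ∈ A, ∀ b ∈ B, ‖(inner ℂ a b : ℂ)‖ ≤ ε * ‖a‖ * ‖b‖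

/-- Two subgroups `H`, `K` of `G` (to be used when `H` and `K` generate `G`) are `ε`-orthogonal
if for every unitary representation of `G` on a complex Hilbert space `V` without nonzero
`G`-invariant vectors, the subspaces `V^H` and `V^K` are `ε`-orthogonal. The Hilbert spaces range
over an arbitrary universe `v`. -/
def SubgroupEpsOrthogonal {G : Type u} [Group G] (ε : ℝ) (H K : Subgroup G) : Prop :=
  ∀ (V : Type v) [NormedAddCommGroup V] [InnerProductSpace ℂ V] [CompleteSpace V]
    (π : UnitaryRep G V),
    UnitaryRep.fixedSubspace π ⊤ = ⊥ →
      SubspaceEpsOrthogonal ε (UnitaryRep.fixedSubspace π H) (UnitaryRep.fixedSubspace π K)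

open Subgroup Filter Topology
open scoped commutatorElement

namespace UnitaryRep

variable {G : Type*} [Group G] {V : Type*} [NormedAddCommGroup V] [InnerProductSpace ℂ V]

/-! Each commutator `c = ⁅x, y⁆` is central, so projecting onto the `c`-fixed vectors preserves
`V^X` and `V^Y`. For `a ∈ V^X` orthogonal to the `c`-fixed vectors, `π y a ⟂ a`, while a
`Y`-invariant `b` has the same inner product with `a` and `π y a`; this yields `1 / √2`
(`inner_apply_self_eq_zero`, `norm_inner_le_of_orthogonal`). Splitting along fixed spaces of central
subgroups carries the bound to finite joins, then by a limit to the join `H` of all `⟨c⟩`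
(`EpsOrthogonalAway.sup`, `epsOrthogonalAway_iSup`). On `V^H` the actions of `X` and `Y` commute,
and absence of invariant vectors makes the two fixed spaces orthogonal there
(`inner_eq_zero_of_commutator_mem`). -/

lemma mem_fixedSubspace {π : UnitaryRep G V} {H : Subgroup G} {v : V} :
    v ∈ fixedSubspace π H ↔ ∀ h ∈ H, π h v = v := Iff.rfl

lemma mul_apply (π : UnitaryRep G V) (g h : G) (v : V) : π (g * h) v = π g (π h v) := by
  rw [map_mul]; rfl

lemma inv_apply_apply (π : UnitaryRep G V) (g : G) (v : V) : π g⁻¹ (π g v) = v := by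
  rw [← mul_apply, inv_mul_cancel, map_one]; rfl

lemma inner_apply_left (π : UnitaryRep G V) (g : G) (v w : V) :
    inner ℂ (π g v) w = inner ℂ v (π g⁻¹ w) := by
  rw [← (π g⁻¹).inner_map_map (π g v) w, inv_apply_apply]

lemma apply_comm (π : UnitaryRep G V) {g h : G} (hgh : g * h = h * g) (v : V) :
    π g (π h v) = π h (π g v) := by
  rw [← mul_apply, hgh, mul_apply]

lemma fixedSubspace_antitone (π : UnitaryRep G V) : Antitone (fixedSubspace π) :=
  fun _ _ hle _ hv h hh => hv h (hle hh)

/-- The stabilizer of a vector. -/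
def stabilizer (π : UnitaryRep G V) (v : V) : Subgroup G where
  carrier := {g | π g v = v}
  mul_mem' {g h} hg hh := by
    change π (g * h) v = v
    rw [mul_apply, hh, hg]
  one_mem' := by
    change π 1 v = v
    rw [map_one]; rfl
  inv_mem' {g} hg := by
    change π g⁻¹ v = v
    nth_rw 1 [← (show π g v = v from hg)]
    exact inv_apply_apply π g v

lemma mem_fixedSubspace_iff_le_stabilizer {π : UnitaryRep G V} {H : Subgroup G} {v : V} :
    v ∈ fixedSubspace π H ↔ H ≤ stabilizer π v := Iff.rfl

lemma fixedSubspace_sup (π : UnitaryRep G V) (H K : Subgroup G) :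
    fixedSubspace π (H ⊔ K) = fixedSubspace π H ⊓ fixedSubspace π K := by
  ext v
  simp only [Submodule.mem_inf, mem_fixedSubspace_iff_le_stabilizer, sup_le_iff]

lemma mem_fixedSubspace_zpowers {π : UnitaryRep G V} {g : G} {v : V} :
    v ∈ fixedSubspace π (zpowers g) ↔ π g v = v := by
  rw [mem_fixedSubspace_iff_le_stabilizer, zpowers_le]; rfl

lemma isClosed_fixedSubspace (π : UnitaryRep G V) (H : Subgroup G) :
    IsClosed (fixedSubspace π H : Set V) := by
  have : (fixedSubspace π H : Set V) = ⋂ h ∈ H, {v | π h v = v} := by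
    ext v; simp [mem_fixedSubspace]
  rw [this]
  exact isClosed_biInter fun h _ => isClosed_eq (π h).continuous continuous_id

instance [CompleteSpace V] (π : UnitaryRep G V) (H : Subgroup G) :
    CompleteSpace (fixedSubspace π H) :=
  (isClosed_fixedSubspace π H).completeSpace_coe

instance [CompleteSpace V] (π : UnitaryRep G V) (H K : Subgroup G) :
    CompleteSpace (fixedSubspace π H ⊓ fixedSubspace π K : Submodule ℂ V) := by
  rw [← fixedSubspace_sup]; infer_instance

/-- The orthogonal projection onto an invariant subspace is equivariant. -/
lemma starProjection_apply_comm (π : UnitaryRep G V) (S : Submodule ℂ V)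
    [S.HasOrthogonalProjection] (K : Subgroup G) (hS : ∀ g ∈ K, ∀ v ∈ S, π g v ∈ S)
    {g : G} (hg : g ∈ K) (v : V) :
    S.starProjection (π g v) = π g (S.starProjection v) := by
  refine Submodule.eq_starProjection_of_mem_orthogonal
    (hS g hg _ (S.starProjection_apply_mem v)) ?_
  rw [← map_sub, Submodule.mem_orthogonal']
  intro w hw
  rw [inner_apply_left]
  exact (Submodule.mem_orthogonal' _ _).1 (S.sub_starProjection_mem_orthogonal v) _
    (hS g⁻¹ (K.inv_mem hg) w hw)

lemma apply_mem_fixedSubspace_of_commute {π : UnitaryRep G V} {H : Subgroup G} {g : G}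
    (hg : ∀ h ∈ H, h * g = g * h) {v : V} (hv : v ∈ fixedSubspace π H) :
    π g v ∈ fixedSubspace π H := fun h hh => by
  rw [apply_comm π (hg h hh), hv h hh]

lemma starProjection_mem_fixedSubspace [CompleteSpace V] (π : UnitaryRep G V) {H K : Subgroup G}
    (hH : H ≤ center G) {v : V} (hv : v ∈ fixedSubspace π K) :
    (fixedSubspace π H).starProjection v ∈ fixedSubspace π K := fun k hk => by
  rw [← starProjection_apply_comm π _ ⊤ (fun g _ v hv =>
    apply_mem_fixedSubspace_of_commute (fun h hh => (mem_center_iff.1 (hH hh) g).symm) hv)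
    (mem_top k), hv k hk]

end UnitaryRep

/-- If `c = ⁅x, y⁆` is central and `x ∈ X`, then `π y a ⟂ a` for every
`X`-invariant vector `a` orthogonal to the `c`-invariant vectors. -/
lemma UnitaryRep.inner_apply_self_eq_zero {G : Type*} [Group G] {V : Type*}
    [NormedAddCommGroup V] [InnerProductSpace ℂ V] [CompleteSpace V] (π : UnitaryRep G V)
    {X : Subgroup G} {x y : G} (hx : x ∈ X) (hc : ⁅x, y⁆ ∈ center G) {a : V}
    (ha : a ∈ fixedSubspace π X) (hac : a ∈ (fixedSubspace π (zpowers ⁅x, y⁆))ᗮ) :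
    inner ℂ (π y a) a = 0 := by
  have hle : zpowers ⁅x, y⁆ ≤ center G := by rwa [zpowers_le]
  set c := ⁅x, y⁆ with hcdef
  have hinv : ∀ g ∈ zpowers c, ∀ v ∈ fixedSubspace π X, π g v ∈ fixedSubspace π X :=
    fun g hg v hv => apply_mem_fixedSubspace_of_commute (fun h _ => mem_center_iff.1 (hle hg) h) hv
  set w := (fixedSubspace π X).starProjection (π y a) with hw
  have hxy : x * y = c * y * x := by rw [hcdef, commutatorElement_def]; group
  have hcy : π c (π y a) = π x (π y a) := by
    rw [← mul_apply, ← mul_apply, hxy, mul_apply π (c * y), ha x hx]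
  -- On `π y a`, `c` acts as `x ∈ X` does, and applying `x` does not change the projection to `V^X`.
  have hcw : π c w = w := by
    rw [hw, ← starProjection_apply_comm π _ _ hinv (mem_zpowers c), hcy]
    refine (Submodule.eq_starProjection_of_mem_orthogonal
      (Submodule.starProjection_apply_mem _ _) ?_)
    rw [Submodule.mem_orthogonal']
    intro v hv
    rw [inner_sub_left, inner_apply_left, hv _ (X.inv_mem hx), ← inner_sub_left]
    exact (Submodule.mem_orthogonal' _ _).1 (Submodule.sub_starProjection_mem_orthogonal _) v hv
  have h0 : inner ℂ (π y a - w) a = 0 :=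
    (Submodule.mem_orthogonal' _ _).1 (Submodule.sub_starProjection_mem_orthogonal _) a ha
  rw [inner_sub_left, sub_eq_zero] at h0
  rw [h0]
  exact hac w (mem_fixedSubspace_zpowers.2 hcw)

/-- A vector having the same inner product with two orthogonal vectors of equal norm makes an angle
of at least `π / 4` with both of them. -/
lemma norm_inner_le_of_orthogonal {V : Type*} [NormedAddCommGroup V] [InnerProductSpace ℂ V]
    {a a' b : V} (hn : ‖a'‖ = ‖a‖) (ho : inner ℂ a' a = 0)
    (hb : (inner ℂ a' b : ℂ) = inner ℂ a b) :
    ‖(inner ℂ a b : ℂ)‖ ≤ 1 / √2 * ‖a‖ * ‖b‖ := by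
  have h1 : ‖a' + a‖ = √2 * ‖a‖ := by
    have h := norm_add_sq_eq_norm_sq_add_norm_sq_of_inner_eq_zero a' a ho
    rw [hn] at h
    rw [← sq_eq_sq₀ (norm_nonneg _) (by positivity), mul_pow, Real.sq_sqrt zero_le_two]
    linarith
  -- Cauchy–Schwarz for `a' + a` and `b`.
  have h2 : 2 * ‖(inner ℂ a b : ℂ)‖ ≤ √2 * ‖a‖ * ‖b‖ := by
    have h := norm_inner_le_norm (𝕜 := ℂ) (a' + a) b
    rw [inner_add_left, hb, ← two_mul, norm_mul, h1] at h
    simpa using h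
  have h3 : 1 / √2 = √2 / 2 := by
    rw [div_eq_div_iff (by positivity) two_ne_zero, Real.mul_self_sqrt zero_le_two, one_mul]
  rw [h3]
  linarith

lemma Submodule.norm_sq_eq_starProjection {V : Type*} [NormedAddCommGroup V]
    [InnerProductSpace ℂ V] (U : Submodule ℂ V) [U.HasOrthogonalProjection] (a : V) :
    ‖a‖ ^ 2 = ‖U.starProjection a‖ ^ 2 + ‖a - U.starProjection a‖ ^ 2 := by
  have h := norm_add_sq_eq_norm_sq_add_norm_sq_of_inner_eq_zero (𝕜 := ℂ) (U.starProjection a)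
    (a - U.starProjection a)
    (U.sub_starProjection_mem_orthogonal a _ (U.starProjection_apply_mem a))
  rw [add_sub_cancel] at h
  linarith

/-- `ε`-orthogonality can be checked on the components of an orthogonal decomposition. -/
lemma norm_inner_le_of_starProjection {V : Type*} [NormedAddCommGroup V] [InnerProductSpace ℂ V]
    (U : Submodule ℂ V) [U.HasOrthogonalProjection] {ε : ℝ} (hε : 0 ≤ ε) {a b : V}
    (h1 : ‖(inner ℂ (U.starProjection a) (U.starProjection b) : ℂ)‖ ≤
      ε * ‖U.starProjection a‖ * ‖U.starProjection b‖)
    (h2 : ‖(inner ℂ (a - U.starProjection a) (b - U.starProjection b) : ℂ)‖ ≤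
      ε * ‖a - U.starProjection a‖ * ‖b - U.starProjection b‖) :
    ‖(inner ℂ a b : ℂ)‖ ≤ ε * ‖a‖ * ‖b‖ := by
  have ha := U.norm_sq_eq_starProjection a
  have hb := U.norm_sq_eq_starProjection b
  have hab : (inner ℂ a b : ℂ) = inner ℂ (U.starProjection a) (U.starProjection b) +
      inner ℂ (a - U.starProjection a) (b - U.starProjection b) := by
    have e1 : inner ℂ (U.starProjection a) (b - U.starProjection b) = (0 : ℂ) :=
      U.sub_starProjection_mem_orthogonal b _ (U.starProjection_apply_mem a)
    have e2 : inner ℂ (a - U.starProjection a) (U.starProjection b) = (0 : ℂ) :=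
      (Submodule.mem_orthogonal' _ _).1 (U.sub_starProjection_mem_orthogonal a) _
        (U.starProjection_apply_mem b)
    rw [inner_sub_left] at e2 ⊢
    rw [inner_sub_right] at e1 ⊢
    rw [inner_sub_right]
    linear_combination e1 + e2
  set p := ‖U.starProjection a‖
  set q := ‖U.starProjection b‖
  set r := ‖a - U.starProjection a‖
  set s := ‖b - U.starProjection b‖
  have hcs : p * q + r * s ≤ ‖a‖ * ‖b‖ := by
    refine abs_le_of_sq_le_sq' ?_ (by positivity) |>.2
    rw [mul_pow, ha, hb]
    nlinarith [sq_nonneg (p * s - r * q)]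
  calc ‖(inner ℂ a b : ℂ)‖ ≤ ε * p * q + ε * r * s := by
        rw [hab]; exact (norm_add_le _ _).trans (add_le_add h1 h2)
    _ = ε * (p * q + r * s) := by ring
    _ ≤ ε * (‖a‖ * ‖b‖) := mul_le_mul_of_nonneg_left hcs hε
    _ = ε * ‖a‖ * ‖b‖ := by ring

/-! ### Gluing bounds over central subgroups -/

namespace UnitaryRep

variable {G : Type*} [Group G] {V : Type*} [NormedAddCommGroup V] [InnerProductSpace ℂ V]

/-- `V^X` and `V^Y` are `ε`-orthogonal inside the orthogonal complement of `V^H`. -/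
def EpsOrthogonalAway (π : UnitaryRep G V) (ε : ℝ) (X Y H : Subgroup G) : Prop :=
  SubspaceEpsOrthogonal ε (fixedSubspace π X ⊓ (fixedSubspace π H)ᗮ)
    (fixedSubspace π Y ⊓ (fixedSubspace π H)ᗮ)

variable [CompleteSpace V] {π : UnitaryRep G V} {X Y H K : Subgroup G} {ε : ℝ}

lemma epsOrthogonalAway_zpowers_commutator {x y : G} (hx : x ∈ X) (hy : y ∈ Y)
    (hc : ⁅x, y⁆ ∈ center G) :
    EpsOrthogonalAway π (1 / √2) X Y (zpowers ⁅x, y⁆) := by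
  rintro a ⟨haX, hac⟩ b ⟨hbY, -⟩
  refine norm_inner_le_of_orthogonal ((π y).norm_map a)
    (inner_apply_self_eq_zero π hx hc haX hac) ?_
  rw [inner_apply_left, hbY _ (Y.inv_mem hy)]

lemma sub_starProjection_mem_inf (hH : H ≤ center G) {a : V} (ha : a ∈ fixedSubspace π X) :
    a - (fixedSubspace π H).starProjection a ∈ fixedSubspace π X ⊓ (fixedSubspace π H)ᗮ :=
  ⟨Submodule.sub_mem _ ha (starProjection_mem_fixedSubspace π hH ha),
    Submodule.sub_starProjection_mem_orthogonal _⟩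

/-- Split along `V^H`: `hH` controls the parts orthogonal to `V^H`. The parts inside `V^H` are
orthogonal to `V^K`, because projecting `V^K` to `V^H` lands in `V^H ⊓ V^K = V^(H ⊔ K)`; there `hK`
applies. -/
lemma EpsOrthogonalAway.sup (hε : 0 ≤ ε) (hHc : H ≤ center G)
    (hH : EpsOrthogonalAway π ε X Y H) (hK : EpsOrthogonalAway π ε X Y K) :
    EpsOrthogonalAway π ε X Y (H ⊔ K) := by
  have key : ∀ (Z : Subgroup G), ∀ a ∈ fixedSubspace π Z ⊓ (fixedSubspace π (H ⊔ K))ᗮ,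
      (fixedSubspace π H).starProjection a ∈ fixedSubspace π Z ⊓ (fixedSubspace π K)ᗮ := by
    rintro Z a ⟨haZ, ha⟩
    refine ⟨starProjection_mem_fixedSubspace π hHc haZ, fun k hk => ?_⟩
    rw [← Submodule.inner_starProjection_left_eq_right]
    refine ha _ ?_
    rw [fixedSubspace_sup]
    exact ⟨Submodule.starProjection_apply_mem _ _, starProjection_mem_fixedSubspace π hHc hk⟩
  intro a ha b hb
  exact norm_inner_le_of_starProjection (fixedSubspace π H) hε
    (hK _ (key X a ha) _ (key Y b hb))
    (hH _ (sub_starProjection_mem_inf hHc ha.1) _ (sub_starProjection_mem_inf hHc hb.1))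

lemma epsOrthogonalAway_finset_sup {ι : Type*} (hε : 0 ≤ ε) (H : ι → Subgroup G)
    (hHc : ∀ i, H i ≤ center G) (hH : ∀ i, EpsOrthogonalAway π ε X Y (H i)) (s : Finset ι) :
    EpsOrthogonalAway π ε X Y (s.sup H) := by
  classical
  induction s using Finset.induction_on with
  | empty =>
    rintro a ⟨-, ha⟩ b -
    have : a = 0 := by
      have h := ha a (by rw [Finset.sup_empty, mem_fixedSubspace_iff_le_stabilizer]; exact bot_le)
      simpa using h
    simp [this]
  | insert i s _ ih =>
    rw [Finset.sup_insert]
    exact (hH i).sup hε (hHc i) ih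

/-- The complements for finite joins increase, and their union is dense in the complement for the
full join, so projecting to them reduces the bound to a limit of finite cases. -/
lemma epsOrthogonalAway_iSup {ι : Type*} (hε : 0 ≤ ε) (H : ι → Subgroup G)
    (hHc : ∀ i, H i ≤ center G) (hH : ∀ i, EpsOrthogonalAway π ε X Y (H i)) :
    EpsOrthogonalAway π ε X Y (⨆ i, H i) := by
  classical
  let U : Finset ι → Submodule ℂ V := fun s => (fixedSubspace π (s.sup H))ᗮ
  have hU : Monotone U := fun s t hst =>
    Submodule.orthogonal_le (fixedSubspace_antitone π (Finset.sup_mono hst))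
  have hle : (fixedSubspace π (⨆ i, H i))ᗮ ≤ (⨆ s, U s).topologicalClosure := by
    rw [← Submodule.orthogonal_orthogonal_eq_closure]
    refine Submodule.orthogonal_le fun v hv => ?_
    rw [mem_fixedSubspace_iff_le_stabilizer, iSup_le_iff]
    intro i
    rw [← mem_fixedSubspace_iff_le_stabilizer,
      ← Submodule.orthogonal_orthogonal (fixedSubspace π (H i))]
    refine Submodule.orthogonal_le (le_trans ?_ (le_iSup U {i})) hv
    simp [U]
  have hlim : ∀ a ∈ (fixedSubspace π (⨆ i, H i))ᗮ,
      Tendsto (fun s => (U s).starProjection a) atTop (𝓝 a) := by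
    intro a ha
    have h := Submodule.starProjection_tendsto_closure_iSup U hU a
    rwa [Submodule.starProjection_eq_self_iff.2 (hle ha)] at h
  have hmem : ∀ (Z : Subgroup G) (s : Finset ι), ∀ a ∈ fixedSubspace π Z,
      (U s).starProjection a ∈ fixedSubspace π Z ⊓ (fixedSubspace π (s.sup H))ᗮ := by
    intro Z s a ha
    have h := sub_starProjection_mem_inf (H := s.sup H) (Finset.sup_le fun i _ => hHc i) ha
    rwa [← Submodule.starProjection_orthogonal_val] at h
  rintro a ⟨haX, ha⟩ b ⟨hbY, hb⟩
  refine le_of_tendsto_of_tendsto' ((hlim a ha).inner (hlim b hb)).norm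
    ((tendsto_const_nhds.mul (hlim a ha).norm).mul (hlim b hb).norm) fun s => ?_
  exact epsOrthogonalAway_finset_sup hε H hHc hH s _ (hmem X s a haX) _ (hmem Y s b hbY)

/-- If `X` and `Y` commute modulo a central subgroup `H` and generate `G`, then without invariant
vectors `V^X` and `V^Y` are orthogonal inside `V^H`. -/
lemma inner_eq_zero_of_commutator_mem (hgen : X ⊔ Y = ⊤) (hinv : fixedSubspace π ⊤ = ⊥)
    (hHc : H ≤ center G) (hcomm : ∀ x ∈ X, ∀ y ∈ Y, ⁅x, y⁆ ∈ H) {a b : V}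
    (ha : a ∈ fixedSubspace π X) (hb : b ∈ fixedSubspace π Y) (hbH : b ∈ fixedSubspace π H) :
    inner ℂ a b = (0 : ℂ) := by
  -- `S` is `X`-stable, so the projection of `a` to `S` is fixed by both `X` and `Y`, hence zero.
  let S : Submodule ℂ V := fixedSubspace π Y ⊓ fixedSubspace π H
  have hS : ∀ x ∈ X, ∀ v ∈ S, π x v ∈ S := by
    rintro x hx v ⟨hvY, hvH⟩
    refine ⟨fun y hy => ?_, apply_mem_fixedSubspace_of_commute
      (fun h hh => (mem_center_iff.1 (hHc hh) x).symm) hvH⟩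
    -- Swapping `y` and `x` costs an element of `H`, which fixes `v`.
    have e : y * x = x * y * ⁅y⁻¹, x⁻¹⁆ := by rw [commutatorElement_def]; group
    have hmem : ⁅y⁻¹, x⁻¹⁆ ∈ H := by
      rw [← commutatorElement_inv]
      exact H.inv_mem (hcomm _ (X.inv_mem hx) _ (Y.inv_mem hy))
    rw [← mul_apply, e, mul_apply, hvH _ hmem, mul_apply, hvY y hy]
  have hw : S.starProjection a ∈ fixedSubspace π ⊤ := by
    rw [← hgen, fixedSubspace_sup]
    refine ⟨fun x hx => ?_, (S.starProjection_apply_mem a).1⟩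
    rw [← starProjection_apply_comm π S X hS hx, ha x hx]
  rw [hinv, Submodule.mem_bot] at hw
  have h := (Submodule.mem_orthogonal' _ _).1 (S.sub_starProjection_mem_orthogonal a) b ⟨hb, hbH⟩
  rwa [hw, sub_zero] at h

end UnitaryRep

lemma Group.commutator_mem_center_of_nilpotencyClass_le_two {G : Type*} [Group G]
    [Group.IsNilpotent G] (hclass : Group.nilpotencyClass G ≤ 2) (x y : G) :
    ⁅x, y⁆ ∈ center G := by
  have hx : x ∈ Subgroup.upperCentralSeries G 2 := by
    rw [Subgroup.upperCentralSeries_eq_top_iff_nilpotencyClass_le.2 hclass]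
    exact mem_top x
  rw [← Subgroup.upperCentralSeries_one]
  exact Subgroup.mem_upperCentralSeries_succ_iff.1 hx y

open UnitaryRep in
theorem mainTheorem7 {G : Type u} [Group G] [Group.IsNilpotent G]
    (hclass : Group.nilpotencyClass G ≤ 2) (X Y : Subgroup G)
    (hX : IsMulCommutative X) (hY : IsMulCommutative Y) (hgen : X ⊔ Y = ⊤) :
    SubgroupEpsOrthogonal.{u, v} (1 / Real.sqrt 2) X Y := by
  intro V _ _ _ π hinv a ha b hb
  have hcen := Group.commutator_mem_center_of_nilpotencyClass_le_two hclass
  let C : X × Y → Subgroup G := fun p => zpowers ⁅(p.1 : G), (p.2 : G)⁆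
  have hC : ∀ p, C p ≤ center G := fun p => zpowers_le.2 (hcen _ _)
  have hH : ⨆ p, C p ≤ center G := iSup_le hC
  have hε : (0 : ℝ) ≤ 1 / √2 := by positivity
  have haway : EpsOrthogonalAway π (1 / √2) X Y (⨆ p, C p) :=
    epsOrthogonalAway_iSup hε C hC fun p =>
      epsOrthogonalAway_zpowers_commutator p.1.2 p.2.2 (hcen _ _)
  refine norm_inner_le_of_starProjection (fixedSubspace π (⨆ p, C p)) hε ?_
    (haway _ (sub_starProjection_mem_inf hH ha) _ (sub_starProjection_mem_inf hH hb))
  rw [inner_eq_zero_of_commutator_mem hgen hinv hH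
    (fun x hx y hy => le_iSup C (⟨x, hx⟩, ⟨y, hy⟩) (mem_zpowers _))
    (starProjection_mem_fixedSubspace π hH ha) (starProjection_mem_fixedSubspace π hH hb)
    (Submodule.starProjection_apply_mem _ _), norm_zero]
  positivity
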